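/- A \emph{rooted tree} is a finite tree whose edges are all directed away from a root. A \emph{dominance drawing} of a directed acyclic graph places its vertices at distinct points of the plane so that, for all vertices $u,v$, there is a directed path (possibly of length $0$) from $u$ to $v$ if and only if both coordinates of $v$ are greater than or equal to the corresponding coordinates of $u$; it is \emph{planar} if, with edges drawn as straight line segments, no edge passes through a vertex other than its ends and two different edges meet only at common ends. The \emph{permutation defined by a dominance drawing} lists the points from left to right (points with equal $x$-coordinate from bottom to top) and records their order from bottom to top (points with equal $y$-coordinate being ordered from left to right). A permutation $\pi$ is a \emph{pattern} of $\sigma$ if some subsequence of $\sigma$ has the same relative order as $\pi$; $\sigma$ \emph{avoids} $\pi$ if $\pi$ is not a pattern of $\sigma$. An \emph{$S_m(213)$-superpattern} is a permutation that has every $213$-avoiding permutation of length $m$ as a pattern. The \emph{plot} of a permutation $\sigma$ of length $k$ is the point set $\{(i,\sigma_i) : 1\le i\le k\}$. \textbf{Theorem.} The permutation defined by any dominance drawing of a rooted tree avoids $213$. Moreover, there exist finite point sets $U_n\subset\mathbb{R}^2$ ($n\ge 1$) such that every rooted tree with $n$ vertices has a planar dominance drawing with all its vertices in $U_n$, and $|U_n|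 = n^2/4+\Theta(n)$, that is, there are constants $c,C>0$ with $n^2/4+cn\le |U_n|\le n^2/4+Cn$ for all $n\ge 1$. In addition, the sets can be chosen so that each $U_n$ is the plot of a permutation whose first element is its smallest and whose remaining elements are order-isomorphic to an $S_{n-1}(213)$-superpattern. -/

import Mathlib

universe u

/-- A rooted (directed) tree: an orientation of an undirected tree (no loops, no pair of opposite
edges) in which every vertex can be reached from some vertex, the root. -/
def IsRootedTree {V : Type*} (G : Digraph V) : Prop :=
  (∀ u v, G.Adj u v → ¬ G.Adj v u) ∧
  G.toSimpleGraphInclusive.IsTree ∧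
  ∃ r : V, ∀ v : V, Relation.ReflTransGen G.Adj r v

/-- `p` places the vertices of `G` at distinct points of the plane so that reachability is the same
relation as dominance (`≤` on `ℝ × ℝ` is the coordinatewise order). -/
def IsDominanceDrawing {V : Type*} (G : Digraph V) (p : V → ℝ × ℝ) : Prop :=
  Function.Injective p ∧ ∀ u v, Relation.ReflTransGen G.Adj u v ↔ p u ≤ p v

/-- The straight-line drawing of `G` with vertex placement `p` is non-crossing: vertices are placed
at distinct points, an edge passes through no vertex but its two ends, and two different edges meet
only in the images of common ends. -/
def IsPlanarDrawing {V : Type*} (G : Digraph V) (p : V → ℝ × ℝ) : Prop :=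
  Function.Injective p ∧
  (∀ u v w, G.Adj u v → p w ∈ segment ℝ (p u) (p v) → w = u ∨ w = v) ∧
  (∀ u v u' v', G.Adj u v → G.Adj u' v' → (u, v) ≠ (u', v') →
    segment ℝ (p u) (p v) ∩ segment ℝ (p u') (p v') ⊆ p '' (({u, v} : Set V) ∩ {u', v'}))

/-- `S` is a universal point set for the planar dominance drawings of rooted trees with `n`
vertices: each such tree has a planar dominance drawing with all its vertices in `S`. -/
def IsUniversalForTrees (n : ℕ) (S : Finset (ℝ × ℝ)) : Prop :=
  ∀ (V : Type u) [Fintype V] (G : Digraph V), Fintype.card V = n → IsRootedTree G →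
    ∃ p : V → ℝ × ℝ, (∀ v, p v ∈ S) ∧ IsDominanceDrawing G p ∧ IsPlanarDrawing G p

/-- `π` is a pattern of `σ`: some subsequence of `σ` is ordered like `π`. -/
def IsPatternOf {m k : ℕ} (π : Equiv.Perm (Fin m)) (σ : Equiv.Perm (Fin k)) : Prop :=
  ∃ l : Fin m ↪o Fin k, ∀ i j, π i < π j ↔ σ (l i) < σ (l j)

/-- The permutation `213` (`102` when the values start from `0`). -/
def perm213 : Equiv.Perm (Fin 3) := Equiv.swap 0 1

/-- `σ` avoids the pattern `213`. -/
def Avoids213 {k : ℕ} (σ : Equiv.Perm (Fin k)) : Prop := ¬ IsPatternOf perm213 σ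

/-- `σ` is an `S_m(213)`-superpattern. -/
def IsSuperpattern213 (m : ℕ) {k : ℕ} (σ : Equiv.Perm (Fin k)) : Prop :=
  ∀ π : Equiv.Perm (Fin m), Avoids213 π → IsPatternOf π σ

/-- The plot of a permutation: the points `(i, σ_i)`, with positions and values starting from
`1`. -/
noncomputable def permPlot {k : ℕ} (σ : Equiv.Perm (Fin k)) : Finset (ℝ × ℝ) :=
  Finset.univ.image fun i : Fin k => (((i : ℕ) : ℝ) + 1, ((σ i : ℕ) : ℝ) + 1)

/-- The permutation whose first element is its smallest and whose remaining elements are ordered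
like `μ`. -/
def prependMin {k : ℕ} (μ : Equiv.Perm (Fin k)) : Equiv.Perm (Fin (k + 1)) :=
  Equiv.Perm.decomposeFin.symm (0, μ)

theorem prependMin_zero {k : ℕ} (μ : Equiv.Perm (Fin k)) : prependMin μ 0 = 0 := by
  simp [prependMin]

theorem prependMin_succ {k : ℕ} (μ : Equiv.Perm (Fin k)) (i : Fin k) :
    prependMin μ i.succ = (μ i).succ := by
  simp [prependMin]

/-- `σ` is the permutation defined by the point placement `p`: the points are listed from left to
right, and `σ` gives their order from bottom to top. Points with equal `x` coordinate are listed
from bottom to top and points with equal `y` coordinate are ordered from left to right, as after a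
small shear that keeps the dominance relation. -/
def IsPermOfDrawing {V : Type*} {n : ℕ} (p : V → ℝ × ℝ) (σ : Equiv.Perm (Fin n)) : Prop :=
  ∃ e : Fin n ≃ V,
    (∀ i j, i < j ↔ toLex (p (e i)) < toLex (p (e j))) ∧
    (∀ i j, σ i < σ j ↔ toLex (p (e i)).swap < toLex (p (e j)).swap)

/-!
In a dominance drawing of a rooted tree the points below a given one form a chain, while the middle
point and the left one of a pattern `213` are incomparable and both lie below the third.

Edges are covering pairs of the dominance order. If two of them meet at a point `z`, both lower
ends lie below `z`, hence below both upper ends, which forces the lower ends to agree unless `z`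
is one of them; and two segments from a common lower end that meet elsewhere lie on one line, so
that one upper end would dominate the other. Hence every dominance drawing of a rooted tree is
planar.

A depth-first traversal assigns nested intervals to nested subtrees. This gives a dominance drawing.
Its permutation is a minimum, for the root, followed by a `213`-avoiding permutation, so that the
plot of a superpattern with a new minimum in front is universal.

In a `213`-avoiding sequence the elements that are at most as high as the last one increase, so that
they fit in one row of points. The elements above them form a `213`-avoiding sequence which misses
the columns of the lowest and of the last element, so the next row needs two points less. Together
with one extra point per row, for the case that the lowest element is in the last column, this gives
a superpattern with about `n + (n - 2) + (n - 4) + ⋯ ≈ n ^ 2 / 4` points.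
-/

/-! ### Forest orders -/

/-- A forest order: the elements below any given one form a chain, as the ancestors of a vertex of
a rooted forest do. -/
def IsForestOrder (V : Type*) [LE V] : Prop :=
  ∀ ⦃u v w : V⦄, u ≤ w → v ≤ w → u ≤ v ∨ v ≤ u

/-- `f` numbers the elements of `s` as a depth-first traversal visits them: an element comes before
its descendants, and these descendants are numbered consecutively. -/
structure IsPreorderTraversal {V : Type*} [Preorder V] (s : Set V) (f : V → ℕ) : Prop where
  injOn : Set.InjOn f s
  monotoneOn : MonotoneOn f s
  le_of_le_of_le : ∀ ⦃a⦄, a ∈ s → ∀ ⦃b⦄, b ∈ s → ∀ ⦃c⦄, c ∈ s →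
    a ≤ c → f a ≤ f b → f b ≤ f c → a ≤ b

namespace IsForestOrder

variable {V : Type*} [PartialOrder V]

theorem eq_or_le_of_covBy (hV : IsForestOrder V) {u v w : V} (huv : u ⋖ v) (hwv : w ≤ v) :
    w = v ∨ w ≤ u := by
  rcases hV hwv huv.le with h | h
  · exact .inr h
  · exact (huv.eq_or_eq h hwv).symm.imp_right le_of_eq

theorem isPreorderTraversal_insert [DecidableEq V] (hV : IsForestOrder V) {s : Set V} {f : V → ℕ}
    (hf : IsPreorderTraversal s f) {v : V} (hv : ∀ x ∈ s, ¬ v ≤ x) {k : ℕ}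
    (lt_k : ∀ x ∈ s, x < v → 2 * f x + 1 < k)
    (le_k : ∀ b, 2 * f b + 1 ≤ k → ∃ x ∈ s, x < v ∧ f b ≤ f x) :
    IsPreorderTraversal (insert v s) (Function.update (fun x => 2 * f x + 1) v k) := by
  have ne_k : ∀ b, 2 * f b + 1 ≠ k := by
    intro b hb
    obtain ⟨x, hx, hxv, hbx⟩ := le_k b hb.le
    have := lt_k x hx hxv
    omega
  have hne : ∀ x ∈ s, x ≠ v := fun x hx h => hv x hx h.ge
  refine ⟨?_, ?_, ?_⟩
  · rintro a (rfl | ha) b (rfl | hb) h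
    · rfl
    · exact absurd (by simpa [hne b hb] using h.symm) (ne_k b)
    · exact absurd (by simpa [hne a ha] using h) (ne_k a)
    · exact hf.injOn ha hb (by simpa [hne a ha, hne b hb] using h)
  · rintro a (rfl | ha) b (rfl | hb) hab
    · rfl
    · exact absurd hab (hv b hb)
    · simpa [hne a ha] using (lt_k a ha (hab.lt_of_ne (hne a ha))).le
    · simpa [hne a ha, hne b hb] using hf.monotoneOn ha hb hab
  · rintro a (rfl | ha) b (rfl | hb) c (rfl | hc) hac hab hbc
    · rfl
    · rfl
    · exact absurd (by simpa [hne b hb] using hbc.antisymm hab) (ne_k b)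
    · exact absurd hac (hv c hc)
    · exact hac
    · obtain ⟨x, hx, hxv, hax⟩ := le_k a (by simpa [hne a ha] using hab)
      have hkc : k ≤ 2 * f c + 1 := by simpa [hne c hc] using hbc
      have hxc : f x ≤ f c := by have := lt_k x hx hxv; omega
      exact (hf.le_of_le_of_le ha hx hc hac hax hxc).trans hxv.le
    · obtain ⟨x, hx, hxv, hbx⟩ := le_k b (by simpa [hne b hb] using hbc)
      have hab' : f a ≤ f b := by simpa [hne a ha, hne b hb] using hab
      rcases hV hac hxv.le with hax | hxa
      · exact hf.le_of_le_of_le ha hb hx hax hab' hbx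
      · exact (hf.injOn ha hb (hab'.antisymm (hbx.trans (hf.monotoneOn hx ha hxa)))).le
    · exact hf.le_of_le_of_le ha hb hc hac (by simpa [hne a ha, hne b hb] using hab)
        (by simpa [hne b hb, hne c hc] using hbc)

theorem exists_isPreorderTraversal_insert (hV : IsForestOrder V) {s : Finset V} {f : V → ℕ}
    (hf : IsPreorderTraversal (s : Set V) f) {v : V} (hv : ∀ x ∈ s, ¬ v ≤ x) :
    ∃ g, IsPreorderTraversal (insert v s : Set V) g := by
  classical
  -- The new leaf `v` is visited right after its parent, the ancestor with the largest number.
  let k := (s.filter (· < v)).sup fun x => 2 * f x + 2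
  refine ⟨_, hV.isPreorderTraversal_insert hf hv (k := k) (fun x hx hxv => ?_) fun b hb => ?_⟩
  · exact Finset.le_sup (f := fun x => 2 * f x + 2) (Finset.mem_filter.2 ⟨hx, hxv⟩)
  · obtain ⟨x, hx, hbx⟩ := (Finset.le_sup_iff (Nat.succ_pos _)).1 hb
    obtain ⟨hxs, hxv⟩ := Finset.mem_filter.1 hx
    exact ⟨x, hxs, hxv, by omega⟩

theorem exists_isPreorderTraversal (hV : IsForestOrder V) (s : Finset V) :
    ∃ f, IsPreorderTraversal (s : Set V) f := by
  classical
  refine Finset.induction_on_max_value (toLinearExtension : V → LinearExtension V) s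
    ⟨fun _ => 0, by simp, by simp [MonotoneOn], by simp⟩ fun v s hv hmax ⟨f, hf⟩ => ?_
  rw [Finset.coe_insert]
  refine hV.exists_isPreorderTraversal_insert hf fun x hx hvx => hv ?_
  have hxv : v = x := (toLinearExtension.monotone hvx).antisymm (hmax x hx)
  exact hxv ▸ hx

theorem nonempty_orderEmbedding_real_prod [Finite V] (hV : IsForestOrder V) :
    Nonempty (V ↪o ℝ × ℝ) := by
  classical
  have := Fintype.ofFinite V
  obtain ⟨f, hf⟩ := hV.exists_isPreorderTraversal Finset.univ
  simp only [Finset.coe_univ] at hf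
  -- `u ≤ v` means that the numbers used in the subtree of `v`, an interval from `f v` to `last v`,
  -- lie in the interval of the subtree of `u`.
  let last : V → ℕ := fun v => (Finset.univ.filter (v ≤ ·)).sup f
  have le_iff : ∀ u v, f u ≤ f v ∧ last v ≤ last u ↔ u ≤ v := by
    refine fun u v => ⟨fun ⟨hfuv, hlast⟩ => ?_, fun huv => ⟨?_, ?_⟩⟩
    · obtain ⟨w, hw, hwu⟩ := Finset.exists_mem_eq_sup (Finset.univ.filter (u ≤ ·))
        ⟨u, by simp⟩ f
      have hfv : f v ≤ last v := Finset.le_sup (f := f) (by simp)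
      exact hf.le_of_le_of_le trivial trivial trivial (Finset.mem_filter.1 hw).2 hfuv
        (hfv.trans (hlast.trans hwu.le))
    · exact hf.monotoneOn trivial trivial huv
    · exact Finset.sup_mono fun w hw => by simpa using huv.trans (Finset.mem_filter.1 hw).2
  exact ⟨OrderEmbedding.ofMapLEIff (fun v => ((f v : ℝ), -(last v : ℝ))) fun u v => by
    simpa using le_iff u v⟩

end IsForestOrder

/-! ### Planarity -/

section Segment

variable {E : Type*} [AddCommGroup E] [PartialOrder E] [IsOrderedAddMonoid E] [Module ℝ E]
  [PosSMulMono ℝ E] [SMulPosMono ℝ E]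

theorem le_or_le_of_mem_segment_of_mem_segment {x y y' z : E} (hy : x ≤ y) (hy' : x ≤ y')
    (hz : z ∈ segment ℝ x y) (hz' : z ∈ segment ℝ x y') (hzx : z ≠ x) : y ≤ y' ∨ y' ≤ y := by
  have le_of_le : ∀ {s t : ℝ} {a b : E}, 0 ≤ b → 0 < s → t ≤ s → s • a = t • b → a ≤ b := by
    intro s t a b hb hs hts hab
    exact le_of_smul_le_smul_of_pos_left (hab.trans_le (smul_le_smul_of_nonneg_right hts hb)) hs
  rw [segment_eq_image'] at hz hz'
  obtain ⟨s, ⟨hs, -⟩, rfl⟩ := hz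
  obtain ⟨t, ⟨ht, -⟩, hst⟩ := hz'
  replace hst : t • (y' - x) = s • (y - x) := add_left_cancel hst
  have hs' : 0 < s := hs.lt_of_ne (by rintro rfl; simp at hzx)
  have ht' : 0 < t := ht.lt_of_ne (by rintro rfl; simp [← hst] at hzx)
  rcases le_total t s with hts | hts
  · exact .inl (sub_le_sub_iff_right x |>.1 (le_of_le (sub_nonneg.2 hy') hs' hts hst.symm))
  · exact .inr (sub_le_sub_iff_right x |>.1 (le_of_le (sub_nonneg.2 hy) ht' hts hst))

theorem IsForestOrder.segment_inter_segment_subset {V : Type*} [PartialOrder V]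
    (hV : IsForestOrder V) (p : V ↪o E) {u v u' v' : V} (huv : u ⋖ v) (huv' : u' ⋖ v')
    (hne : v ≠ v') :
    segment ℝ (p u) (p v) ∩ segment ℝ (p u') (p v') ⊆ p '' (({u, v} : Set V) ∩ {u', v'}) := by
  rintro z ⟨hz, hz'⟩
  obtain ⟨huz, hzv⟩ := segment_subset_Icc (p.monotone huv.le) hz
  obtain ⟨huz', hzv'⟩ := segment_subset_Icc (p.monotone huv'.le) hz'
  rcases hV.eq_or_le_of_covBy huv' (p.le_iff_le.1 (huz.trans hzv')) with rfl | huu'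
  · exact ⟨u, by simp, huz.antisymm hzv'⟩
  rcases hV.eq_or_le_of_covBy huv (p.le_iff_le.1 (huz'.trans hzv)) with rfl | hu'u
  · exact ⟨u', by simp, huz'.antisymm hzv⟩
  obtain rfl := huu'.antisymm hu'u
  by_contra hzu
  have hzu : z ≠ p u := fun h => hzu ⟨u, by simp, h.symm⟩
  rcases le_or_le_of_mem_segment_of_mem_segment (p.monotone huv.le) (p.monotone huv'.le) hz hz' hzu
    with h | h
  · exact hne ((huv'.eq_or_eq huv.le (p.le_iff_le.1 h)).resolve_left huv.ne')
  · exact hne.symm ((huv.eq_or_eq huv'.le (p.le_iff_le.1 h)).resolve_left huv'.ne')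

end Segment

/-! ### Rooted trees -/

theorem eq_of_adj_of_dist_eq_add_one {V : Type*} {G : SimpleGraph V} (hG : G.IsTree) {r u v w : V}
    (hu : G.Adj u w) (hv : G.Adj v w) (hdu : G.dist r w = G.dist r u + 1)
    (hdv : G.dist r w = G.dist r v + 1) : u = v := by
  classical
  obtain ⟨p, hp, -⟩ := hG.connected.exists_path_of_dist r w
  have eq_penultimate : ∀ x, G.Adj x w → G.dist r w = G.dist r x + 1 → x = p.penultimate := by
    intro x hx hd
    obtain ⟨q, hq, hlen⟩ := hG.connected.exists_path_of_dist r x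
    have hwq : w ∉ q.support := fun hw => by
      have := SimpleGraph.dist_le (q.takeUntil w hw)
      have := q.length_takeUntil_le_length hw
      omega
    exact hG.isAcyclic.eq_penultimate_of_adj_end hp hx.symm
      (hG.isAcyclic.mem_support_of_ne_mem_support_of_adj_of_isPath hp hq hx.symm hwq)
  exact (eq_penultimate u hu hdu).trans (eq_penultimate v hv hdv).symm

namespace IsRootedTree

open Relation

variable {V : Type*} {G : Digraph V}

theorem toSimpleGraphInclusive_adj (hG : IsRootedTree G) {u v : V} (h : G.Adj u v) :
    G.toSimpleGraphInclusive.Adj u v :=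
  (SimpleGraph.fromRel_adj _ _ _).2 ⟨by rintro rfl; exact hG.1 _ _ h h, .inl h⟩

theorem dist_eq_add_one_of_adj (hG : IsRootedTree G) {r u v : V} (hru : ReflTransGen G.Adj r u)
    (huv : G.Adj u v) :
    G.toSimpleGraphInclusive.dist r v = G.toSimpleGraphInclusive.dist r u + 1 := by
  induction hru generalizing v with
  | refl =>
    rw [SimpleGraph.dist_self,
      SimpleGraph.dist_eq_one_iff_adj.2 (hG.toSimpleGraphInclusive_adj huv)]
  | @tail x u _ hxu ih =>
    have hadj := hG.toSimpleGraphInclusive_adj huv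
    refine (hG.2.1.dist_eq_dist_add_one_of_adj r hadj).resolve_left fun h => ?_
    have hxv : x = v := eq_of_adj_of_dist_eq_add_one hG.2.1 (hG.toSimpleGraphInclusive_adj hxu)
      hadj.symm (ih hxu) h
    exact hG.1 _ _ hxu (hxv ▸ huv)

theorem parent_unique (hG : IsRootedTree G) {u v w : V} (hu : G.Adj u w) (hv : G.Adj v w) :
    u = v := by
  obtain ⟨r, hr⟩ := hG.2.2
  exact eq_of_adj_of_dist_eq_add_one hG.2.1 (hG.toSimpleGraphInclusive_adj hu)
    (hG.toSimpleGraphInclusive_adj hv) (hG.dist_eq_add_one_of_adj (hr u) hu)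
    (hG.dist_eq_add_one_of_adj (hr v) hv)

theorem reach_antisymm (hG : IsRootedTree G) {u v : V} (huv : ReflTransGen G.Adj u v)
    (hvu : ReflTransGen G.Adj v u) : u = v := by
  obtain ⟨r, hr⟩ := hG.2.2
  let depth := G.toSimpleGraphInclusive.dist r
  have eq_or_depth_lt : ∀ {a b}, ReflTransGen G.Adj a b → a = b ∨ depth a < depth b := by
    intro a b h
    induction h with
    | refl => exact .inl rfl
    | tail _ hbc ih =>
      have hdepth : depth _ = depth _ + 1 := hG.dist_eq_add_one_of_adj (hr _) hbc
      rcases ih with rfl | ih <;> right <;> omega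
  have := eq_or_depth_lt huv
  have := eq_or_depth_lt hvu
  grind

/-- Reachability as an order on the vertices: `u ≤ v` if `u` is an ancestor of `v` or `v`
itself. -/
abbrev ancestorOrder (hG : IsRootedTree G) : PartialOrder V where
  le := ReflTransGen G.Adj
  le_refl _ := .refl
  le_trans _ _ _ := .trans
  le_antisymm _ _ := hG.reach_antisymm

theorem isForestOrder (hG : IsRootedTree G) :
    @IsForestOrder V hG.ancestorOrder.toLE := by
  intro u v w hu hv
  have parent_rightUnique : Relator.RightUnique (Function.swap G.Adj) :=
    fun _ _ _ => hG.parent_unique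
  exact ((ReflTransGen.total_of_right_unique parent_rightUnique (reflTransGen_swap.2 hu)
    (reflTransGen_swap.2 hv)).imp reflTransGen_swap.1 reflTransGen_swap.1).symm

theorem covBy_of_adj (hG : IsRootedTree G) {u v : V} (huv : G.Adj u v) :
    @CovBy V hG.ancestorOrder.toLT u v := by
  let _ := hG.ancestorOrder
  have hle : u ≤ v := ReflTransGen.single huv
  refine ⟨hle.lt_of_ne fun h => hG.1 u v huv (h ▸ huv), fun w huw hwv => ?_⟩
  rcases ReflTransGen.cases_tail hwv.le with h | ⟨x, hwx, hxv⟩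
  · exact hwv.ne h.symm
  · exact huw.not_ge (hG.parent_unique huv hxv ▸ hwx)

theorem le_or_le_of_isDominanceDrawing (hG : IsRootedTree G) {p : V → ℝ × ℝ}
    (hp : IsDominanceDrawing G p) (u v w : V) (hu : p u ≤ p w) (hv : p v ≤ p w) :
    p u ≤ p v ∨ p v ≤ p u :=
  (hG.isForestOrder ((hp.2 u w).2 hu) ((hp.2 v w).2 hv)).imp (hp.2 u v).1 (hp.2 v u).1

theorem isPlanarDrawing (hG : IsRootedTree G) {p : V → ℝ × ℝ} (hp : IsDominanceDrawing G p) :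
    IsPlanarDrawing G p := by
  let _ := hG.ancestorOrder
  let p' : V ↪o ℝ × ℝ := OrderEmbedding.ofMapLEIff p fun u v => (hp.2 u v).symm
  refine ⟨hp.1, fun u v w huv hw => ?_, fun u v u' v' huv huv' hne => ?_⟩
  · obtain ⟨huw, hwv⟩ := segment_subset_Icc (p'.monotone (hG.covBy_of_adj huv).le) hw
    exact (hG.covBy_of_adj huv).eq_or_eq ((hp.2 u w).2 huw) ((hp.2 w v).2 hwv)
  · refine hG.isForestOrder.segment_inter_segment_subset p' (hG.covBy_of_adj huv)
      (hG.covBy_of_adj huv') ?_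
    rintro rfl
    exact hne (by rw [hG.parent_unique huv huv'])

theorem exists_isDominanceDrawing [Finite V] (hG : IsRootedTree G) :
    ∃ p : V → ℝ × ℝ, IsDominanceDrawing G p := by
  let _ := hG.ancestorOrder
  obtain ⟨p⟩ := hG.isForestOrder.nonempty_orderEmbedding_real_prod
  exact ⟨p, p.injective, fun u v => p.le_iff_le.symm⟩

end IsRootedTree

/-! ### Permutations of drawings -/

section Pattern

variable {m k : ℕ} {π : Equiv.Perm (Fin m)} {σ : Equiv.Perm (Fin k)}

theorem isPatternOf_of_strictMono {f : Fin m → Fin k} (hf : StrictMono f)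
    (h : ∀ i j, π i < π j → σ (f i) < σ (f j)) : IsPatternOf π σ := by
  refine ⟨OrderEmbedding.ofStrictMono f hf, fun i j => ⟨h i j, fun hij => ?_⟩⟩
  by_contra! hji
  rcases hji.eq_or_lt with hji | hji
  · exact hij.ne (by rw [π.injective hji])
  · exact hij.asymm (h j i hji)

theorem avoids213_iff :
    Avoids213 σ ↔ ∀ a b c, a < b → b < c → σ b < σ a → ¬ σ a < σ c := by
  refine ⟨fun h a b c hab hbc hba hac => h (isPatternOf_of_strictMono (f := ![a, b, c]) ?_ ?_), ?_⟩
  · intro i j hij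
    fin_cases i <;> fin_cases j <;> simp_all [hab.trans hbc]
  · intro i j hij
    have hbc := hba.trans hac
    fin_cases i <;> fin_cases j <;> simp_all [perm213, Equiv.swap_apply_def]
  · rintro h ⟨l, hl⟩
    exact h (l 0) (l 1) (l 2) (l.lt_iff_lt.2 (by decide)) (l.lt_iff_lt.2 (by decide))
      ((hl 1 0).1 (by decide)) ((hl 0 2).1 (by decide))

end Pattern

theorem exists_equiv_fin_lt_iff {V L : Type*} [Fintype V] [LinearOrder L] {n : ℕ}
    (hV : Fintype.card V = n) {f : V → L} (hf : Function.Injective f) :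
    ∃ e : Fin n ≃ V, ∀ i j, i < j ↔ f (e i) < f (e j) := by
  let _ : LinearOrder V := LinearOrder.lift' f hf
  let e := Fintype.orderIsoFinOfCardEq V hV
  exact ⟨e.toEquiv, fun i j => (e.lt_iff_lt (x := i) (y := j)).symm⟩

theorem exists_isPermOfDrawing {V : Type*} [Fintype V] {n : ℕ} (hV : Fintype.card V = n)
    {p : V → ℝ × ℝ} (hp : Function.Injective p) :
    ∃ σ : Equiv.Perm (Fin n), IsPermOfDrawing p σ := by
  obtain ⟨e, he⟩ := exists_equiv_fin_lt_iff hV (toLex.injective.comp hp)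
  obtain ⟨e', he'⟩ := exists_equiv_fin_lt_iff hV
    (toLex.injective.comp (Prod.swap_injective.comp hp))
  exact ⟨e.trans e'.symm, e, he, fun i j => by simp [he']⟩

theorem le_iff_toLex_le_and_toLex_swap_le {α β : Type*} [PartialOrder α] [PartialOrder β]
    {x y : α × β} : x ≤ y ↔ toLex x ≤ toLex y ∧ toLex x.swap ≤ toLex y.swap :=
  ⟨fun h => ⟨Prod.Lex.toLex_mono h, Prod.Lex.toLex_mono (Prod.swap_le_swap.2 h)⟩,
    fun ⟨h₁, h₂⟩ => ⟨Prod.Lex.monotone_fst _ _ h₁, Prod.Lex.monotone_fst _ _ h₂⟩⟩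

namespace IsPermOfDrawing

variable {V : Type*} {n k : ℕ} {p : V → ℝ × ℝ} {σ : Equiv.Perm (Fin n)} {μ : Equiv.Perm (Fin k)}

theorem exists_equiv (h : IsPermOfDrawing p σ) :
    ∃ e : Fin n ≃ V, ∀ i j, p (e i) ≤ p (e j) ↔ i ≤ j ∧ σ i ≤ σ j := by
  obtain ⟨e, he, hσ⟩ := h
  refine ⟨e, fun i j => ?_⟩
  rw [le_iff_toLex_le_and_toLex_swap_le, ← not_lt, ← he, not_lt,
    ← not_lt (b := toLex (p (e i)).swap), ← hσ, not_lt]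

theorem avoids213 (h : IsPermOfDrawing p σ)
    (hp : ∀ u v w, p u ≤ p w → p v ≤ p w → p u ≤ p v ∨ p v ≤ p u) : Avoids213 σ := by
  obtain ⟨e, he⟩ := h.exists_equiv
  refine avoids213_iff.2 fun a b c hab hbc hba hac => ?_
  rcases hp (e a) (e b) (e c) ((he a c).2 ⟨(hab.trans hbc).le, hac.le⟩)
    ((he b c).2 ⟨hbc.le, (hba.trans hac).le⟩) with h | h
  · exact hba.not_ge ((he a b).1 h).2
  · exact hab.not_ge ((he b a).1 h).1

theorem exists_index (h : IsPermOfDrawing p σ) (hσ : IsPatternOf σ μ) :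
    ∃ i : V → Fin k, ∀ u v, p u ≤ p v ↔ i u ≤ i v ∧ μ (i u) ≤ μ (i v) := by
  obtain ⟨e, he⟩ := h.exists_equiv
  obtain ⟨l, hl⟩ := hσ
  refine ⟨fun v => l (e.symm v), fun u v => ?_⟩
  rw [l.le_iff_le, ← not_lt (a := μ _), ← hl, not_lt, ← he, e.apply_symm_apply, e.apply_symm_apply]

theorem isPatternOf (h : IsPermOfDrawing p μ) {φ : Fin n → V}
    (hφ : ∀ i j, i < j → toLex (p (φ i)) < toLex (p (φ j)))
    (hσφ : ∀ i j, σ i < σ j → toLex (p (φ i)).swap < toLex (p (φ j)).swap) : IsPatternOf σ μ := by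
  obtain ⟨e, he, hμ⟩ := h
  refine isPatternOf_of_strictMono (f := fun i => e.symm (φ i)) (fun i j hij => ?_) ?_
  · simpa [he] using hφ i j hij
  · simpa [hμ] using hσφ

end IsPermOfDrawing

/-! ### Universal point sets from superpatterns -/

theorem card_permPlot {k : ℕ} (σ : Equiv.Perm (Fin k)) : (permPlot σ).card = k := by
  rw [permPlot, Finset.card_image_of_injective, Finset.card_univ, Fintype.card_fin]
  intro i j h
  have hij : (i : ℝ) + 1 = (j : ℝ) + 1 := congrArg Prod.fst h
  exact Fin.ext (by exact_mod_cast add_right_cancel hij)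

theorem exists_index_prependMin {V α : Type*} [PartialOrder α] {p : V → α}
    (hp : Function.Injective p) {r : V} (hr : ∀ v, p r ≤ p v) {k : ℕ} {μ : Equiv.Perm (Fin k)}
    {i : {v // v ≠ r} → Fin k}
    (hi : ∀ u v : {v // v ≠ r}, p u ≤ p v ↔ i u ≤ i v ∧ μ (i u) ≤ μ (i v)) :
    ∃ j : V → Fin (k + 1),
      ∀ u v, p u ≤ p v ↔ j u ≤ j v ∧ prependMin μ (j u) ≤ prependMin μ (j v) := by
  classical
  refine ⟨fun v => if h : v = r then 0 else (i ⟨v, h⟩).succ, fun u v => ?_⟩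
  by_cases hu : u = r
  · simp [hu, hr, prependMin_zero]
  · by_cases hv : v = r
    · subst hv
      have hle : ¬ p u ≤ p v := fun h => hu (hp (h.antisymm (hr u)))
      simp [hu, hle]
    · simpa [hu, hv, prependMin_succ] using hi ⟨u, hu⟩ ⟨v, hv⟩

theorem IsDominanceDrawing.exists_mem_permPlot {V : Type*} {G : Digraph V} {p : V → ℝ × ℝ}
    (hp : IsDominanceDrawing G p) {k : ℕ} {σ : Equiv.Perm (Fin k)} {j : V → Fin k}
    (hj : ∀ u v, p u ≤ p v ↔ j u ≤ j v ∧ σ (j u) ≤ σ (j v)) :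
    ∃ q, (∀ v, q v ∈ permPlot σ) ∧ IsDominanceDrawing G q := by
  let q : V → ℝ × ℝ := fun v => ((j v : ℕ) + 1, (σ (j v) : ℕ) + 1)
  have hq : ∀ u v, p u ≤ p v ↔ q u ≤ q v := fun u v => by simp [hj, q]
  refine ⟨q, fun v => Finset.mem_image_of_mem _ (Finset.mem_univ (j v)), fun u v huv => hp.1 ?_,
    fun u v => (hp.2 u v).trans (hq u v)⟩
  exact ((hq u v).2 huv.le).antisymm ((hq v u).2 huv.ge)

theorem IsSuperpattern213.isUniversalForTrees {n k : ℕ} {μ : Equiv.Perm (Fin k)}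
    (hμ : IsSuperpattern213 (n - 1) μ) :
    IsUniversalForTrees.{u} n (permPlot (prependMin μ)) := by
  classical
  intro V _ G hV hG
  obtain ⟨r, hr⟩ := hG.2.2
  obtain ⟨p, hp⟩ := hG.exists_isDominanceDrawing
  obtain ⟨π, hπ⟩ := exists_isPermOfDrawing (V := {v : V // v ≠ r}) (n := n - 1)
    (by simp [Fintype.card_subtype_compl, hV]) (hp.1.comp Subtype.val_injective)
  have hπ213 : Avoids213 π := 
    hπ.avoids213 fun u v w => hG.le_or_le_of_isDominanceDrawing hp u v w
  obtain ⟨i, hi⟩ := hπ.exists_index (hμ π hπ213)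
  obtain ⟨j, hj⟩ := exists_index_prependMin hp.1 (fun v => (hp.2 r v).1 (hr v)) hi
  obtain ⟨q, hqmem, hq⟩ := hp.exists_mem_permPlot hj
  exact ⟨q, hqmem, hq, hG.isPlanarDrawing hq⟩

/-! ### Superpatterns from nested rows -/

/-- The elements of `A`, listed by `col` from left to right, have distinct values `val` which form a
`213`-avoiding sequence. -/
structure Avoids213On {ι : Type*} (A : Finset ι) (col val : ι → ℕ) : Prop where
  col_injOn : Set.InjOn col A
  val_injOn : Set.InjOn val A
  not_lt : ∀ ⦃a⦄, a ∈ A → ∀ ⦃b⦄, b ∈ A → ∀ ⦃c⦄, c ∈ A →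
    col a < col b → col b < col c → val b < val a → ¬ val a < val c

/-- `φ` places the elements of `A` in the grid so that `col` is their order from left to right and
`val` their order from bottom to top, with ties broken as for the permutation of a drawing. The
bounds on the column of `φ a` are what an induction over the rows needs: it is at most `col a`, and
at least `col r` for some `r` below or equal to `a` in the dominance order. -/
structure IsColumnDrawing {ι : Type*} (A : Finset ι) (col val : ι → ℕ) (φ : ι → ℕ × ℕ) : Prop where
  lt_of_col_lt : ∀ ⦃a⦄, a ∈ A → ∀ ⦃b⦄, b ∈ A → col a < col b → toLex (φ a) < toLex (φ b)
  lt_of_val_lt : ∀ ⦃a⦄, a ∈ A → ∀ ⦃b⦄, b ∈ A → val a < val b →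
    toLex (φ a).swap < toLex (φ b).swap
  fst_le : ∀ ⦃a⦄, a ∈ A → (φ a).1 ≤ col a
  le_fst : ∀ ⦃a⦄, a ∈ A → ∃ r ∈ A, col r ≤ col a ∧ val r ≤ val a ∧ col r ≤ (φ a).1

/-- Every `213`-avoiding sequence in columns `0, …, n - 1` has a column drawing with its points
in `P`. -/
def IsColumnUniversal (n : ℕ) (P : Finset (ℕ × ℕ)) : Prop :=
  ∀ ⦃ι : Type⦄ ⦃A : Finset ι⦄ ⦃col val : ι → ℕ⦄, Avoids213On A col val → (∀ a ∈ A, col a < n) →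
    ∃ φ, IsColumnDrawing A col val φ ∧ ∀ a ∈ A, φ a ∈ P

/-- The column of `x` after the removal of the empty column `k`. -/
def collapse (k x : ℕ) : ℕ := if k < x then x - 1 else x

theorem strictMonoOn_collapse (k : ℕ) : StrictMonoOn (collapse k) {k}ᶜ := by
  intro x hx y hy hxy
  grind [collapse]

theorem collapse_le (k x : ℕ) : collapse k x ≤ x := by
  grind [collapse]

theorem le_collapse_of_lt (k : ℕ) {x y : ℕ} (h : x < y) : x ≤ collapse k y := by
  grind [collapse]

theorem collapse_of_le {k x : ℕ} (h : x ≤ k) : collapse k x = x :=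
  if_neg h.not_gt

theorem collapse_lt {n k x : ℕ} (hk : k ≤ n) (hx : x ≤ n) (hxk : x ≠ k) : collapse k x < n := by
  grind [collapse]

/-- The points of `P` two rows higher, above `n` points in row `1`. -/
def addRow (n : ℕ) (P : Finset (ℕ × ℕ)) : Finset (ℕ × ℕ) :=
  Finset.range n ×ˢ {1} ∪ P.image (Prod.map id (· + 2))

/-- Places an element of value at most `c` in row `1` of its own column, and the others as `ψ` does,
two rows higher. -/
def rowDrawing {ι : Type*} (col val : ι → ℕ) (c : ℕ) (ψ : ι → ℕ × ℕ) (a : ι) : ℕ × ℕ :=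
  if val a ≤ c then (col a, 1) else ((ψ a).1, (ψ a).2 + 2)

section RowDrawing

variable {ι : Type*} {col val : ι → ℕ} {c : ℕ} {ψ : ι → ℕ × ℕ} {a : ι}

theorem rowDrawing_of_le (h : val a ≤ c) : rowDrawing col val c ψ a = (col a, 1) :=
  if_pos h

theorem rowDrawing_of_lt (h : c < val a) :
    rowDrawing col val c ψ a = ((ψ a).1, (ψ a).2 + 2) :=
  if_neg h.not_ge

theorem rowDrawing_fst_le (hψ : c < val a → (ψ a).1 ≤ col a) :
    (rowDrawing col val c ψ a).1 ≤ col a := by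
  rcases le_or_gt (val a) c with hac | hca
  · rw [rowDrawing_of_le hac]
  · rw [rowDrawing_of_lt hca]
    exact hψ hca

theorem rowDrawing_mem_addRow {n : ℕ} {P : Finset (ℕ × ℕ)} (hcol : col a < n)
    (hψ : c < val a → ψ a ∈ P) : rowDrawing col val c ψ a ∈ addRow n P := by
  rcases le_or_gt (val a) c with hac | hca
  · simp [rowDrawing_of_le hac, addRow, hcol]
  · rw [rowDrawing_of_lt hca]
    exact Finset.mem_union_right _ (Finset.mem_image_of_mem (Prod.map id (· + 2)) (hψ hca))

end RowDrawing

theorem one_le_snd_of_mem_addRow {n : ℕ} {P : Finset (ℕ × ℕ)} {x : ℕ × ℕ} (hx : x ∈ addRow n P) :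
    1 ≤ x.2 := by
  simp only [addRow, Finset.mem_union, Finset.mem_product, Finset.mem_singleton,
    Finset.mem_image] at hx
  obtain ⟨-, hx⟩ | ⟨y, -, rfl⟩ := hx
  · exact hx.ge
  · simp

theorem card_addRow (n : ℕ) (P : Finset (ℕ × ℕ)) : (addRow n P).card = n + P.card := by
  have hdisj : Disjoint (Finset.range n ×ˢ {1}) (P.image (Prod.map id (· + 2))) := by
    simp [Finset.disjoint_left]
  rw [addRow, Finset.card_union_of_disjoint hdisj, Finset.card_product, Finset.card_range,
    Finset.card_singleton, mul_one,
    Finset.card_image_of_injective _ (Function.injective_id.prodMap (add_left_injective 2))]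

namespace Avoids213On

variable {ι : Type*} {A : Finset ι} {col val : ι → ℕ}

theorem mono {B : Finset ι} (h : Avoids213On A col val) (hBA : B ⊆ A) : Avoids213On B col val where
  col_injOn := h.col_injOn.mono hBA
  val_injOn := h.val_injOn.mono hBA
  not_lt _ ha _ hb _ hc := h.not_lt (hBA ha) (hBA hb) (hBA hc)

theorem col_ne (h : Avoids213On A col val) {a b : ι} (ha : a ∈ A) (hb : b ∈ A)
    (hab : val a < val b) : col a ≠ col b :=
  fun e => hab.ne (by rw [h.col_injOn ha hb e])

theorem val_ne (h : Avoids213On A col val) {a b : ι} (ha : a ∈ A) (hb : b ∈ A)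
    (hab : col a < col b) : val a ≠ val b :=
  fun e => hab.ne (by rw [h.val_injOn ha hb e])

theorem col_lt_of_val_lt (h : Avoids213On A col val) {a b z : ι} (ha : a ∈ A) (hb : b ∈ A)
    (hz : z ∈ A) (hlast : ∀ a ∈ A, col a ≤ col z) (hbz : val b ≤ val z) (hab : val a < val b) :
    col a < col b := by
  by_contra! hba
  have hba : col b < col a := hba.lt_of_ne (h.col_ne ha hb hab).symm
  have haz : col a < col z := (hlast a ha).lt_of_ne (h.col_ne ha hz (hab.trans_le hbz))
  exact h.not_lt hb ha hz hba haz hab (hbz.lt_of_ne (h.val_ne hb hz (hba.trans haz)))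

theorem col_lt_of_val_le (h : Avoids213On A col val) {a b r : ι} (ha : a ∈ A) (hb : b ∈ A)
    (hr : r ∈ A) (hrb : val r ≤ val b) (har : val a < val r)
    (hab : col a < col b) : col a < col r := by
  by_contra! hra
  have hra : col r < col a := hra.lt_of_ne (h.col_ne ha hr har).symm
  exact h.not_lt hr ha hb hra hab har (hrb.lt_of_ne (h.val_ne hr hb (hra.trans hab)))

theorem collapse_comp (h : Avoids213On A col val) {k : ℕ} (hk : ∀ a ∈ A, col a ≠ k) :
    Avoids213On A (collapse k ∘ col) val where
  col_injOn := (strictMonoOn_collapse k).injOn.comp h.col_injOn hk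
  val_injOn := h.val_injOn
  not_lt a ha b hb c hc hab hbc := h.not_lt ha hb hc
    (((strictMonoOn_collapse k).lt_iff_lt (hk a ha) (hk b hb)).1 hab)
    (((strictMonoOn_collapse k).lt_iff_lt (hk b hb) (hk c hc)).1 hbc)

theorem le_fst_of_col_lt (h : Avoids213On A col val) {c k : ℕ} {ψ : ι → ℕ × ℕ}
    (hψ : IsColumnDrawing (A.filter (c < val ·)) (collapse k ∘ col) val ψ) {a b : ι} (ha : a ∈ A)
    (hac : val a ≤ c) (hb : b ∈ A) (hcb : c < val b) (hab : col a < col b) : col a ≤ (ψ b).1 := by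
  obtain ⟨r, hr, -, hrb, hrψ⟩ := hψ.le_fst (Finset.mem_filter.2 ⟨hb, hcb⟩)
  obtain ⟨hrA, hcr⟩ := Finset.mem_filter.1 hr
  have har : col a < col r := h.col_lt_of_val_le ha hb hrA hrb (hac.trans_lt hcr) hab
  exact (le_collapse_of_lt k har).trans hrψ

theorem exists_le_rowDrawing_fst (h : Avoids213On A col val) {c : ℕ} {w : ι} {ψ : ι → ℕ × ℕ}
    (hw : w ∈ A) (hwc : val w ≤ c) (hlow : ∀ a ∈ A, val w ≤ val a)
    (hψ : IsColumnDrawing (A.filter (c < val ·)) (collapse (col w) ∘ col) val ψ) {a : ι}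
    (ha : a ∈ A) :
    ∃ r ∈ A, col r ≤ col a ∧ val r ≤ val a ∧ col r ≤ (rowDrawing col val c ψ a).1 := by
  rcases le_or_gt (val a) c with hac | hca
  · exact ⟨a, ha, le_rfl, le_rfl, by rw [rowDrawing_of_le hac]⟩
  rw [rowDrawing_of_lt hca]
  rcases le_or_gt (col a) (col w) with haw | hwa
  · obtain ⟨r, hr, hra, hra', hrψ⟩ := hψ.le_fst (Finset.mem_filter.2 ⟨ha, hca⟩)
    obtain ⟨hrA, hcr⟩ := Finset.mem_filter.1 hr
    have hra : col r ≤ col a := ((strictMonoOn_collapse _).le_iff_le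
      (h.col_ne hw hrA (hwc.trans_lt hcr)).symm (h.col_ne hw ha (hwc.trans_lt hca)).symm).1 hra
    rw [Function.comp_apply, collapse_of_le (hra.trans haw)] at hrψ
    exact ⟨r, hrA, hra, hra', hrψ⟩
  · exact ⟨w, hw, hwa.le, hlow a ha, h.le_fst_of_col_lt hψ hw hwc ha hca hwa⟩

theorem isColumnDrawing_rowDrawing (h : Avoids213On A col val) {w z : ι} {ψ : ι → ℕ × ℕ}
    (hw : w ∈ A) (hz : z ∈ A) (hlow : ∀ a ∈ A, val w ≤ val a) (hlast : ∀ a ∈ A, col a ≤ col z)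
    (hψ : IsColumnDrawing (A.filter (val z < val ·)) (collapse (col w) ∘ col) val ψ) :
    IsColumnDrawing A col val (rowDrawing col val (val z) ψ) := by
  have hne : ∀ a ∈ A, val z < val a → col a ≠ col w := fun a ha hza =>
    (h.col_ne hw ha ((hlow z hz).trans_lt hza)).symm
  have fst_le : ∀ a ∈ A, (rowDrawing col val (val z) ψ a).1 ≤ col a := fun a ha =>
    rowDrawing_fst_le fun hza =>
      (hψ.fst_le (Finset.mem_filter.2 ⟨ha, hza⟩)).trans (collapse_le _ _)
  refine ⟨fun a ha b hb hab => ?_, fun a ha b hb hab => ?_, fst_le,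
    fun a ha => h.exists_le_rowDrawing_fst hw (hlow z hz) hlow hψ ha⟩
  · rcases le_or_gt (val b) (val z) with hbz | hzb
    · rw [rowDrawing_of_le hbz]
      exact Prod.Lex.toLex_lt_toLex.2 (.inl ((fst_le a ha).trans_lt hab))
    rcases le_or_gt (val a) (val z) with haz | hza
    · rw [rowDrawing_of_le haz, rowDrawing_of_lt hzb, Prod.Lex.toLex_lt_toLex']
      exact ⟨h.le_fst_of_col_lt hψ ha haz hb hzb hab, by simp⟩
    · have := hψ.lt_of_col_lt (Finset.mem_filter.2 ⟨ha, hza⟩) (Finset.mem_filter.2 ⟨hb, hzb⟩)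
        (strictMonoOn_collapse _ (hne a ha hza) (hne b hb hzb) hab)
      simpa [rowDrawing_of_lt hza, rowDrawing_of_lt hzb, Prod.Lex.toLex_lt_toLex] using this
  · rcases le_or_gt (val a) (val z) with haz | hza
    · rcases le_or_gt (val b) (val z) with hbz | hzb
      · simpa [rowDrawing_of_le haz, rowDrawing_of_le hbz, Prod.Lex.toLex_lt_toLex]
          using h.col_lt_of_val_lt ha hb hz hlast hbz hab
      · simp [rowDrawing_of_le haz, rowDrawing_of_lt hzb, Prod.Lex.toLex_lt_toLex]
    · have := hψ.lt_of_val_lt (Finset.mem_filter.2 ⟨ha, hza⟩)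
        (Finset.mem_filter.2 ⟨hb, hza.trans hab⟩) hab
      simpa [rowDrawing_of_lt hza, rowDrawing_of_lt (hza.trans hab), Prod.Lex.toLex_lt_toLex]
        using this

end Avoids213On

theorem isColumnDrawing_const_zero {ι : Type*} {A : Finset ι} {col val : ι → ℕ}
    (h : Avoids213On A col val) (hcol : ∀ a ∈ A, col a = 0) :
    IsColumnDrawing A col val fun _ => (0, 0) where
  lt_of_col_lt a ha b hb hab := by simp [hcol a ha, hcol b hb] at hab
  lt_of_val_lt a ha b hb hab := absurd ((hcol a ha).trans (hcol b hb).symm) (h.col_ne ha hb hab)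
  fst_le _ _ := Nat.zero_le _
  le_fst a ha := ⟨a, ha, le_rfl, le_rfl, (hcol a ha).le⟩

theorem IsColumnDrawing.update_last {ι : Type*} [DecidableEq ι] {A : Finset ι} {col val : ι → ℕ}
    {φ : ι → ℕ × ℕ} {w : ι} (hφ : IsColumnDrawing (A.erase w) col val φ)
    (hlow : ∀ a ∈ A, val w ≤ val a) (hlast : ∀ a ∈ A.erase w, col a < col w)
    (hφ_pos : ∀ a ∈ A.erase w, 1 ≤ (φ a).2) :
    IsColumnDrawing A col val (Function.update φ w (col w, 0)) := by
  refine ⟨fun a ha b hb hab => ?_, fun a ha b hb hab => ?_, fun a ha => ?_, fun a ha => ?_⟩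
  · have haw : a ≠ w := by
      rintro rfl
      exact hab.not_gt (hlast b (Finset.mem_erase.2 ⟨fun e => hab.ne (by rw [e]), hb⟩))
    have ha := Finset.mem_erase.2 ⟨haw, ha⟩
    rcases eq_or_ne b w with rfl | hbw
    · rw [Function.update_of_ne haw, Function.update_self]
      exact Prod.Lex.toLex_lt_toLex.2 (.inl ((hφ.fst_le ha).trans_lt hab))
    · simpa [haw, hbw] using hφ.lt_of_col_lt ha (Finset.mem_erase.2 ⟨hbw, hb⟩) hab
  · have hbw : b ≠ w := by
      rintro rfl
      exact hab.not_ge (hlow a ha)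
    have hb := Finset.mem_erase.2 ⟨hbw, hb⟩
    rcases eq_or_ne a w with rfl | haw
    · rw [Function.update_of_ne hbw, Function.update_self]
      exact Prod.Lex.toLex_lt_toLex.2 (.inl (hφ_pos b hb))
    · simpa [haw, hbw] using hφ.lt_of_val_lt (Finset.mem_erase.2 ⟨haw, ha⟩) hb hab
  · rcases eq_or_ne a w with rfl | haw
    · simp
    · simpa [haw] using hφ.fst_le (Finset.mem_erase.2 ⟨haw, ha⟩)
  · rcases eq_or_ne a w with rfl | haw
    · exact ⟨a, ha, by simp⟩
    · obtain ⟨r, hr, hra⟩ := hφ.le_fst (Finset.mem_erase.2 ⟨haw, ha⟩)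
      exact ⟨r, Finset.mem_of_mem_erase hr, by simpa [haw] using hra⟩

namespace IsColumnUniversal

variable {n : ℕ} {P : Finset (ℕ × ℕ)}

theorem exists_isColumnDrawing_addRow (hP : IsColumnUniversal n P) {ι : Type} {A : Finset ι}
    {col val : ι → ℕ} (h : Avoids213On A col val) (hcol : ∀ a ∈ A, col a < n + 2)
    (hlow : ∀ w ∈ A, (∀ a ∈ A, val w ≤ val a) → col w ≤ n) :
    ∃ φ, IsColumnDrawing A col val φ ∧ ∀ a ∈ A, φ a ∈ addRow (n + 2) P := by
  rcases A.eq_empty_or_nonempty with rfl | hA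
  · exact ⟨fun _ => (0, 0), isColumnDrawing_const_zero h (by simp), by simp⟩
  obtain ⟨w, hw, hwmin⟩ := A.exists_min_image val hA
  obtain ⟨z, hz, hlast⟩ := A.exists_max_image col hA
  -- The elements at most as high as the last one, `z`, increase and go to row `1`. The others avoid
  -- the column of the lowest element `w` and the last column, so `n` columns suffice for them.
  have hupper : ∀ a ∈ A.filter (val z < val ·), a ∈ A ∧ col a ≠ col w ∧ col a ≤ n := by
    intro a ha
    obtain ⟨haA, hza⟩ := Finset.mem_filter.1 ha
    have haz : col a < col z := (hlast a haA).lt_of_ne (h.col_ne hz haA hza).symm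
    exact ⟨haA, (h.col_ne hw haA ((hwmin z hz).trans_lt hza)).symm,
      Nat.lt_succ_iff.1 (haz.trans_le (Nat.lt_succ_iff.1 (hcol z hz)))⟩
  obtain ⟨ψ, hψ, hψP⟩ := hP
    ((h.mono (Finset.filter_subset _ A)).collapse_comp fun a ha => (hupper a ha).2.1)
    fun a ha => collapse_lt (hlow w hw hwmin) (hupper a ha).2.2 (hupper a ha).2.1
  exact ⟨_, h.isColumnDrawing_rowDrawing hw hz hwmin hlast hψ, fun a ha =>
    rowDrawing_mem_addRow (hcol a ha) fun hza => hψP a (Finset.mem_filter.2 ⟨ha, hza⟩)⟩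

theorem insert_addRow (hP : IsColumnUniversal n P) :
    IsColumnUniversal (n + 2) (insert (n + 1, 0) (addRow (n + 2) P)) := by
  classical
  intro ι A col val h hcol
  by_cases hlow : ∀ w ∈ A, (∀ a ∈ A, val w ≤ val a) → col w ≤ n
  · obtain ⟨φ, hφ, hφP⟩ := hP.exists_isColumnDrawing_addRow h hcol hlow
    exact ⟨φ, hφ, fun a ha => Finset.mem_insert_of_mem (hφP a ha)⟩
  -- A lowest element in the last column takes the extra point below the row.
  push Not at hlow
  obtain ⟨w, hw, hwmin, hnw⟩ := hlow
  have hwn : col w = n + 1 := by have := hcol w hw; omega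
  have hlt : ∀ a ∈ A.erase w, col a < n + 1 := by
    intro a ha
    obtain ⟨haw, haA⟩ := Finset.mem_erase.1 ha
    exact (Nat.lt_succ_iff.1 (hcol a haA)).lt_of_ne fun e =>
      haw (h.col_injOn haA hw (e.trans hwn.symm))
  obtain ⟨φ, hφ, hφP⟩ := hP.exists_isColumnDrawing_addRow (h.mono (A.erase_subset w))
    (fun a ha => (hlt a ha).trans (Nat.lt_succ_self _)) fun a ha _ => Nat.lt_succ_iff.1 (hlt a ha)
  refine ⟨_, hφ.update_last hwmin (by rwa [hwn])
    fun a ha => one_le_snd_of_mem_addRow (hφP a ha), fun a ha => ?_⟩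
  rcases eq_or_ne a w with rfl | haw
  · simp [hwn]
  · simpa [haw] using Or.inr (hφP a (Finset.mem_erase.2 ⟨haw, ha⟩))

end IsColumnUniversal

/-- The union of a row of `n`, a row of `n - 2`, … points, two rows apart, with a point added below
the end of each row. -/
def nestedRows : ℕ → Finset (ℕ × ℕ)
  | 0 => ∅
  | 1 => {(0, 0)}
  | n + 2 => insert (n + 1, 0) (addRow (n + 2) (nestedRows n))

theorem card_nestedRows (n : ℕ) : (nestedRows n).card = n * (n + 4) / 4 := by
  induction n using Nat.twoStepInduction with
  | zero => rfl
  | one => rfl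
  | more n ih _ =>
    have hnotMem : (n + 1, 0) ∉ addRow (n + 2) (nestedRows n) := fun h => by
      simpa using one_le_snd_of_mem_addRow h
    have hsq : (n + 2) * (n + 2 + 4) = n * (n + 4) + 4 * (n + 3) := by ring
    rw [nestedRows, Finset.card_insert_of_notMem hnotMem, card_addRow, ih, hsq]
    omega

theorem isColumnUniversal_nestedRows (n : ℕ) : IsColumnUniversal n (nestedRows n) := by
  induction n using Nat.twoStepInduction with
  | zero =>
    exact fun _ _ _ _ h hcol => ⟨_, isColumnDrawing_const_zero h fun a ha =>
      absurd (hcol a ha) (by simp), fun a ha => absurd (hcol a ha) (by simp)⟩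
  | one =>
    exact fun _ _ _ _ h hcol => ⟨_, isColumnDrawing_const_zero h fun a ha => by
      simpa using hcol a ha, fun _ _ => by simp [nestedRows]⟩
  | more n ih _ => exact ih.insert_addRow

theorem Avoids213.avoids213On {m : ℕ} {π : Equiv.Perm (Fin m)} (h : Avoids213 π) :
    Avoids213On Finset.univ (fun i : Fin m => (i : ℕ)) fun i => (π i : ℕ) where
  col_injOn := Fin.val_injective.injOn
  val_injOn := (Fin.val_injective.comp π.injective).injOn
  not_lt a _ b _ c _ := avoids213_iff.1 h a b c

theorem IsColumnUniversal.exists_isSuperpattern213 {m : ℕ} {P : Finset (ℕ × ℕ)}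
    (hP : IsColumnUniversal m P) : ∃ μ : Equiv.Perm (Fin P.card), IsSuperpattern213 m μ := by
  let p : P → ℝ × ℝ := fun x => Prod.map Nat.cast Nat.cast x.1
  have hp : Function.Injective p :=
    (Nat.cast_injective.prodMap Nat.cast_injective).comp Subtype.val_injective
  obtain ⟨μ, hμ⟩ := exists_isPermOfDrawing (Fintype.card_coe P) hp
  refine ⟨μ, fun π hπ => ?_⟩
  obtain ⟨φ, hφ, hφP⟩ := hP hπ.avoids213On fun i _ => i.isLt
  refine hμ.isPatternOf (φ := fun i => ⟨φ i, hφP i (Finset.mem_univ i)⟩) (fun i j hij => ?_)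
    fun i j hij => ?_
  · simpa [p, Prod.Lex.toLex_lt_toLex] using
      hφ.lt_of_col_lt (Finset.mem_univ i) (Finset.mem_univ j) hij
  · simpa [p, Prod.Lex.toLex_lt_toLex] using
      hφ.lt_of_val_lt (Finset.mem_univ i) (Finset.mem_univ j) hij

theorem exists_isSuperpattern213 (m : ℕ) :
    ∃ μ : Equiv.Perm (Fin (m * (m + 4) / 4)), IsSuperpattern213 m μ :=
  card_nestedRows m ▸ (isColumnUniversal_nestedRows m).exists_isSuperpattern213

theorem sq_div_four_add_le (m : ℕ) :
    ((m + 1 : ℕ) : ℝ) ^ 2 / 4 + 1 / 2 * (m + 1 : ℕ) ≤ (m * (m + 4) / 4 + 1 : ℕ) := by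
  have h : m * (m + 4) ≤ 4 * (m * (m + 4) / 4) + 1 := by
    obtain ⟨k, rfl | rfl⟩ := m.even_or_odd'
    · have : 2 * k * (2 * k + 4) = 4 * (k * (k + 2)) := by ring
      omega
    · have : (2 * k + 1) * (2 * k + 1 + 4) = 4 * (k * (k + 3) + 1) + 1 := by ring
      omega
  have h' : (m : ℝ) * (m + 4) ≤ 4 * (m * (m + 4) / 4 : ℕ) + 1 := by exact_mod_cast h
  push_cast at h' ⊢
  linarith

theorem le_sq_div_four_add (m : ℕ) :
    ((m * (m + 4) / 4 + 1 : ℕ) : ℝ) ≤ ((m + 1 : ℕ) : ℝ) ^ 2 / 4 + 1 * (m + 1 : ℕ) := by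
  have h : ((m * (m + 4) / 4 : ℕ) : ℝ) ≤ m * (m + 4) / 4 := by
    exact_mod_cast Nat.cast_div_le (α := ℝ) (m := m * (m + 4)) (n := 4)
  push_cast at h ⊢
  linarith

theorem mainTheorem7 :
    (∀ (V : Type u) (G : Digraph V) (p : V → ℝ × ℝ) (n : ℕ) (σ : Equiv.Perm (Fin n)),
      IsRootedTree G → IsDominanceDrawing G p → IsPermOfDrawing p σ → Avoids213 σ) ∧
    ∃ U : ℕ → Finset (ℝ × ℝ),
      (∀ n : ℕ, 1 ≤ n → IsUniversalForTrees.{u} n (U n)) ∧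
      (∀ n : ℕ, 1 ≤ n → ∃ (k : ℕ) (μ : Equiv.Perm (Fin k)),
        IsSuperpattern213 (n - 1) μ ∧ U n = permPlot (prependMin μ)) ∧
      ∃ c C : ℝ, 0 < c ∧ 0 < C ∧ ∀ n : ℕ, 1 ≤ n →
        (n : ℝ) ^ 2 / 4 + c * n ≤ ((U n).card : ℝ) ∧
        ((U n).card : ℝ) ≤ (n : ℝ) ^ 2 / 4 + C * n := by
  refine ⟨fun V G p n σ hG hp hσ => hσ.avoids213 (hG.le_or_le_of_isDominanceDrawing hp), ?_⟩
  choose μ hμ using exists_isSuperpattern213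
  refine ⟨fun n => permPlot (prependMin (μ (n - 1))), fun n _ => (hμ (n - 1)).isUniversalForTrees,
    fun n _ => ⟨_, μ (n - 1), hμ (n - 1), rfl⟩, 1 / 2, 1, by norm_num, one_pos, fun n hn => ?_⟩
  obtain ⟨m, rfl⟩ := Nat.exists_eq_add_of_le' hn
  rw [card_permPlot, Nat.add_sub_cancel]
  exact ⟨sq_div_four_add_le m, le_sq_div_four_add m⟩
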